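/- Let $d,M\in\{1,2,\dots\}$, let $t_1,\dots,t_M\in[0,1)^d$, and let $x_j=(e^{2\pi i t_{j,1}},\dots,e^{2\pi i t_{j,d}})\in\mathbb{T}^d=\{z\in\mathbb{C}:|z|=1\}^d$ be pairwise distinct. Let $f:\mathbb{Z}^d\to\mathbb{C}$ be the $M$-sparse exponential sum $$f(k)=\sum_{j=1}^M \hat f_j\,x_j^{k},\qquad x_j^k=\prod_{i=1}^d x_{j,i}^{k_i},$$ with coefficients $\hat f_j\in\mathbb{C}\setminus\{0\}$, and let $\Omega=\{x_1,\dots,x_M\}$. Let $q>0$ and suppose that the parameters are $q$-separated, i.e. $$\min_{r\in\mathbb{Z}^d,\ j\neq\ell}\|t_j-t_\ell+r\|_\infty>q$$ (no condition if $M=1$). If $n\in\mathbb{N}_0$ satisfies $n>d^{3/2}/q+d+1$, then $$\Omega=\Big\{z\in\mathbb{C}^d:\ \sum_{k\in\{0,\dots,n\}^d}p_k z^k=0\ \text{ for all } p=(p_k)\in\ker T_n\Big\},$$ where $T_n=(f(\ell-k))_{k,\ell\in\{0,\dots,n\}^d}\in\mathbb{C}^{(n+1)^d\times(n+1)^d}$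 ($k$ is the row index, $\ell$ the column index) and $\ker T_n=\{p: T_np=0\}$. That is, $\Omega$ is the common zero set of the polynomials whose coefficient vectors lie in $\ker T_n$. -/

import Mathlib

/-- The parametrization `t ↦ (e^{2πi t₁}, …, e^{2πi t_d})` of the torus
`{z ∈ ℂ : |z| = 1}^d` by `[0,1)^d`. -/
noncomputable def torusPoint {d : ℕ} (t : Fin d → ℝ) : Fin d → ℂ :=
  fun i => Complex.exp (2 * (Real.pi : ℂ) * Complex.I * (t i : ℂ))

/-- `f : ℤ^d → ℂ` is the `M`-sparse exponential sum `f(k) = ∑ j, c_j x_j^k` with nonzero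
coefficients `c_j` and pairwise distinct parameters `x_j` (having nonzero entries, so that negative
powers make sense). -/
structure IsExpSum {d M : ℕ} (f : (Fin d → ℤ) → ℂ) (c : Fin M → ℂ)
    (x : Fin M → Fin d → ℂ) : Prop where
  coeff_ne_zero : ∀ j, c j ≠ 0
  param_ne_zero : ∀ j i, x j i ≠ 0
  param_injective : Function.Injective x
  eq_sum : ∀ k : Fin d → ℤ, f k = ∑ j, c j * ∏ i, x j i ^ k i

/-- The wrap-around separation distance `min_{r ∈ ℤ^d, j ≠ l} ‖t_j - t_l + r‖_∞`
(the norm on `Fin d → ℝ` is the sup norm). The minimum over the empty set, which occurs when there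
is only one point, is `∞`. -/
noncomputable def separation {d M : ℕ} (t : Fin M → Fin d → ℝ) : ENNReal :=
  ⨅ (j : Fin M) (l : Fin M) (_ : j ≠ l) (r : Fin d → ℤ),
    ENNReal.ofReal ‖t j - t l + fun i => (r i : ℝ)‖

/-- The points are `q`-separated if their separation distance is larger than `q`. -/
def QSeparated {d M : ℕ} (q : ℝ) (t : Fin M → Fin d → ℝ) : Prop :=
  ENNReal.ofReal q < separation t

/-- The multilevel Toeplitz matrix of trigonometric moments of order up to `n`: its rows `k` and
columns `l` are indexed by `{0,…,n}^d`, and its `(k, l)` entry is `f (l - k)`. For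
`f(k) = ∑ j, c_j x_j^k` on the torus it is `F* diag(c) F` with `F = (x_j^k)_{j,k}`. -/
def toeplitzMatrix {d : ℕ} (n : ℕ) (f : (Fin d → ℤ) → ℂ) :
    Matrix (Fin d → Fin (n + 1)) (Fin d → Fin (n + 1)) ℂ :=
  Matrix.of fun k l => f fun i => ((l i : ℕ) : ℤ) - ((k i : ℕ) : ℤ)

/-- The polynomial `∑ k, p_k X^k` with coefficient vector `p` indexed by `{0,…,n}^d`. -/
noncomputable def polyOfVec {d n : ℕ} (p : (Fin d → Fin (n + 1)) → ℂ) :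
    MvPolynomial (Fin d) ℂ :=
  ∑ k : Fin d → Fin (n + 1),
    MvPolynomial.monomial (Finsupp.equivFunOnFinite.symm fun i => (k i : ℕ)) (p k)

/-- The common zero set in `ℂ^d` of a set of polynomials. -/
def commonZeros {d : ℕ} (P : Set (MvPolynomial (Fin d) ℂ)) : Set (Fin d → ℂ) :=
  {z | ∀ p ∈ P, MvPolynomial.eval z p = 0}

/-- The polynomials whose coefficient vectors lie in the kernel of the matrix `A`. -/
def kernelPolys {d n : ℕ} (A : Matrix (Fin d → Fin (n + 1)) (Fin d → Fin (n + 1)) ℂ) :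
    Set (MvPolynomial (Fin d) ℂ) :=
  polyOfVec '' {p | A.mulVec p = 0}

/-!
The Toeplitz matrix factors as `T_n = F* diag(c) F` with the multivariate Vandermonde matrix
`F = (x_j^k)`. Everything follows from one fact, `eq_zero_of_sum_mul_prod_pow_eq_zero`: already for
exponents `k ∈ {0,…,n-1}^d` the rows of the Vandermonde matrix are linearly independent. First, `F*`
is then injective, so `ker T_n = ker F` consists of the polynomials of degree at most `n` in each
variable that vanish on `Ω` (`toeplitzMatrix_mulVec_eq_zero_iff`). Second, there are Lagrange
polynomials `L_j` of degree at most `n - 1` in each variable, so `(X_i - x_{j,i}) L_j` and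
`1 - ∑ L_j` lie in the kernel. At a common zero outside `Ω` the former force `L_j = 0` for all `j`,
and the latter gives `1 = 0` (`mem_range_of_forall_evalVec_eq_zero`).

The linear independence is an Ingham-type argument (`eq_zero_of_sum_torusChar_eq_zero`). Let
`g(k) = ∑ b_j e^{2πi k·t_j}` vanish on the cube `{-m,…,m}^d`, put `R = m + 1`, and consider the weight
`w(k) = (R² - |k|²) ∏ h(k_i)`, where `h(k) = sin⁴(πkq/2) / k⁴` is proportional to the Fourier
coefficients of a cubic B-spline supported on `[-q, q]`. Since `w ≤ 0` outside the cube, `∑ w(k) |g(k)|² ≤ 0`. On the other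
hand this sum equals `∑ b_j conj(b_l) W(t_j - t_l)` with `W(s) = ∑ w(k) e^{2πi k·s}`. The series of
`h(k)` and of `k² h(k)` are fourth central differences of Bernoulli polynomials. They vanish at
distance at least `q` from the integers, so `W(t_j - t_l) = 0` for `j ≠ l`, and their values
`π⁴q³/12` and `π²q/4` at `0` show `W(0) > 0` as soon as `3d < (πqR)²`. Hence `b = 0`.

For `d ≥ 2` the hypothesis on `n` implies the last inequality, with `R ≥ n/2`. For `d = 1` it need not,
but then there are at most `n` nodes and the classical Vandermonde determinant suffices.
-/

/-! ### Characters of the torus -/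

/-- The character `x ↦ e^{2πix}` of `ℝ`, with values in `ℂ`. -/
noncomputable def expTwoPi (x : ℝ) : ℂ :=
  Complex.exp (2 * (Real.pi : ℂ) * Complex.I * (x : ℂ))

theorem expTwoPi_add (x y : ℝ) : expTwoPi (x + y) = expTwoPi x * expTwoPi y := by
  simp only [expTwoPi, ← Complex.exp_add]
  congr 1
  push_cast
  ring

@[simp]
theorem expTwoPi_zero : expTwoPi 0 = 1 := by simp [expTwoPi]

theorem expTwoPi_ne_zero (x : ℝ) : expTwoPi x ≠ 0 := Complex.exp_ne_zero _

@[simp]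
theorem expTwoPi_intCast (m : ℤ) : expTwoPi m = 1 := by
  rw [expTwoPi, ← Complex.exp_int_mul_two_pi_mul_I m]
  congr 1
  push_cast
  ring

theorem expTwoPi_neg (x : ℝ) : expTwoPi (-x) = (expTwoPi x)⁻¹ := by
  refine eq_inv_of_mul_eq_one_left ?_
  rw [← expTwoPi_add, neg_add_cancel, expTwoPi_zero]

theorem conj_expTwoPi (x : ℝ) : (starRingEnd ℂ) (expTwoPi x) = expTwoPi (-x) := by
  simp only [expTwoPi, ← Complex.exp_conj]
  congr 1
  simp [Complex.conj_ofNat]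

theorem expTwoPi_intCast_mul (x : ℝ) (m : ℤ) : expTwoPi (m * x) = expTwoPi x ^ m := by
  rw [expTwoPi, expTwoPi, ← Complex.exp_int_mul]
  congr 1
  push_cast
  ring

theorem expTwoPi_mul_add_intCast (k : ℤ) (x : ℝ) (m : ℤ) :
    expTwoPi (k * (x + m)) = expTwoPi (k * x) := by
  rw [mul_add, expTwoPi_add]
  have : (k : ℝ) * m = ((k * m : ℤ) : ℝ) := by push_cast; rfl
  rw [this, expTwoPi_intCast, mul_one]

/-! ### The Fourier series of a cubic B-spline -/

theorem bernoulliFun_four (x : ℝ) :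
    bernoulliFun 4 x = x ^ 4 - 2 * x ^ 3 + x ^ 2 - 30⁻¹ := by
  have h4 : bernoulli 4 = -1/30 := by
    rw [bernoulli_eq_bernoulli'_of_ne_one (by decide), bernoulli'_four]
  have h3 : bernoulli 3 = 0 := by
    rw [bernoulli_eq_bernoulli'_of_ne_one (by decide), bernoulli'_three]
  simp [bernoulliFun, Polynomial.bernoulli_def, Finset.sum_range_succ, h3, h4, Nat.choose]
  ring

theorem hasSum_pow_mul_expTwoPi {r : ℕ} (hr : 2 ≤ r) {x : ℝ} (hx : x ∈ Set.Icc (0 : ℝ) 1) :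
    HasSum (fun k : ℤ => 1 / (k : ℂ) ^ r * expTwoPi (k * x))
      (-(2 * Real.pi * Complex.I) ^ r / r.factorial * bernoulliFun r x) := by
  convert! hasSum_one_div_pow_mul_fourier_mul_bernoulliFun hr hx using 3 with k
  rw [fourier_coe_apply, expTwoPi]
  congr 1
  push_cast
  ring

/-- The Fourier expansion of `sin⁴`: multiplication by `sin⁴(πkq/2)` turns a Fourier series in `s`
into its fourth central difference of step `q/2`. -/
theorem sin_pow_four_mul_expTwoPi (q s : ℝ) (k : ℤ) :
    (Real.sin (Real.pi * k * q / 2) : ℂ) ^ 4 * expTwoPi (k * s) =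
      1 / 16 * (expTwoPi (k * (s + q)) - 4 * expTwoPi (k * (s + q / 2)) + 6 * expTwoPi (k * s)
        - 4 * expTwoPi (k * (s - q / 2)) + expTwoPi (k * (s - q))) := by
  set w := expTwoPi (k * q / 4) with hw
  have hw0 : w ≠ 0 := expTwoPi_ne_zero _
  have hsin : (Real.sin (Real.pi * k * q / 2) : ℂ) = (w⁻¹ - w) * Complex.I / 2 := by
    rw [Complex.ofReal_sin, Complex.sin, hw, ← expTwoPi_neg, expTwoPi, expTwoPi]
    congr 4
    · push_cast; ring
    · push_cast; ring
  have e1 : expTwoPi (k * q / 2) = w ^ 2 := by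
    rw [sq, hw, ← expTwoPi_add]; congr 1; ring
  have e2 : expTwoPi (k * q) = w ^ 4 := by
    rw [show w ^ 4 = w ^ 2 * w ^ 2 by ring, ← e1, ← expTwoPi_add]; congr 1; ring
  have a1 : expTwoPi (k * (s + q)) = expTwoPi (k * s) * w ^ 4 := by
    rw [← e2, ← expTwoPi_add]; congr 1; ring
  have a2 : expTwoPi (k * (s + q / 2)) = expTwoPi (k * s) * w ^ 2 := by
    rw [← e1, ← expTwoPi_add]; congr 1; ring
  have a3 : expTwoPi (k * (s - q)) = expTwoPi (k * s) * (w ^ 4)⁻¹ := by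
    rw [← e2, ← expTwoPi_neg, ← expTwoPi_add]; congr 1; ring
  have a4 : expTwoPi (k * (s - q / 2)) = expTwoPi (k * s) * (w ^ 2)⁻¹ := by
    rw [← e1, ← expTwoPi_neg, ← expTwoPi_add]; congr 1; ring
  rw [hsin, a1, a2, a3, a4, div_pow, mul_pow, Complex.I_pow_four]
  field_simp
  ring

theorem hasSum_sin_pow_four_div_pow {r : ℕ} (hr : 2 ≤ r) {q s y₁ y₂ y₃ y₄ y₅ : ℝ}
    (h₁ : y₁ ∈ Set.Icc (0 : ℝ) 1) (h₂ : y₂ ∈ Set.Icc (0 : ℝ) 1) (h₃ : y₃ ∈ Set.Icc (0 : ℝ) 1)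
    (h₄ : y₄ ∈ Set.Icc (0 : ℝ) 1) (h₅ : y₅ ∈ Set.Icc (0 : ℝ) 1)
    (e₁ : ∀ k : ℤ, expTwoPi (k * (s + q)) = expTwoPi (k * y₁))
    (e₂ : ∀ k : ℤ, expTwoPi (k * (s + q / 2)) = expTwoPi (k * y₂))
    (e₃ : ∀ k : ℤ, expTwoPi (k * s) = expTwoPi (k * y₃))
    (e₄ : ∀ k : ℤ, expTwoPi (k * (s - q / 2)) = expTwoPi (k * y₄))
    (e₅ : ∀ k : ℤ, expTwoPi (k * (s - q)) = expTwoPi (k * y₅)) :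
    HasSum (fun k : ℤ => (Real.sin (Real.pi * k * q / 2) : ℂ) ^ 4 / (k : ℂ) ^ r * expTwoPi (k * s))
      (-(2 * Real.pi * Complex.I) ^ r / r.factorial / 16 *
        (bernoulliFun r y₁ - 4 * bernoulliFun r y₂ + 6 * bernoulliFun r y₃
          - 4 * bernoulliFun r y₄ + bernoulliFun r y₅ : ℝ)) := by
  have H := (((((hasSum_pow_mul_expTwoPi hr h₁).sub
    ((hasSum_pow_mul_expTwoPi hr h₂).mul_left 4)).add
    ((hasSum_pow_mul_expTwoPi hr h₃).mul_left 6)).sub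
    ((hasSum_pow_mul_expTwoPi hr h₄).mul_left 4)).add
    (hasSum_pow_mul_expTwoPi hr h₅)).mul_left (1 / 16 : ℂ)
  convert! H using 1
  · funext k
    rw [div_mul_eq_mul_div, sin_pow_four_mul_expTwoPi, e₁, e₂, e₃, e₄, e₅]
    ring
  · push_cast
    ring

/-- Up to a constant factor, the squared Fourier coefficients of the triangular bump supported on
`[-q/2, q/2]`: those of its self-convolution, a cubic B-spline supported on `[-q, q]`.
The value at `0` is the continuous extension of the formula. -/
noncomputable def splineCoeff (q : ℝ) (k : ℤ) : ℝ :=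
  if k = 0 then (Real.pi * q / 2) ^ 4 else Real.sin (Real.pi * k * q / 2) ^ 4 / (k : ℝ) ^ 4

theorem splineCoeff_nonneg (q : ℝ) (k : ℤ) : 0 ≤ splineCoeff q k := by
  unfold splineCoeff
  split_ifs
  · exact Even.pow_nonneg (by decide) _
  · exact div_nonneg (Even.pow_nonneg (by decide) _) (Even.pow_nonneg (by decide) _)

theorem splineCoeff_mul_expTwoPi (q s : ℝ) (k : ℤ) :
    (splineCoeff q k : ℂ) * expTwoPi (k * s) =
      (if k = 0 then ((Real.pi * q / 2 : ℝ) : ℂ) ^ 4 else 0) +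
        (Real.sin (Real.pi * k * q / 2) : ℂ) ^ 4 / (k : ℂ) ^ 4 * expTwoPi (k * s) := by
  unfold splineCoeff
  split_ifs with h
  · simp [h]
  · push_cast
    ring

theorem sq_mul_splineCoeff_mul_expTwoPi (q s : ℝ) (k : ℤ) :
    (((k : ℝ) ^ 2 * splineCoeff q k : ℝ) : ℂ) * expTwoPi (k * s) =
      (Real.sin (Real.pi * k * q / 2) : ℂ) ^ 4 / (k : ℂ) ^ 2 * expTwoPi (k * s) := by
  unfold splineCoeff
  split_ifs with h
  · simp [h]
  · have : (k : ℂ) ≠ 0 := by exact_mod_cast h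
    push_cast
    field_simp

theorem hasSum_splineCoeff_zero {q : ℝ} (hq : 0 < q) (hq1 : q ≤ 1) :
    HasSum (fun k : ℤ => (splineCoeff q k : ℂ) * expTwoPi (k * 0))
      ((Real.pi ^ 4 * q ^ 3 / 12 : ℝ) : ℂ) := by
  simp_rw [splineCoeff_mul_expTwoPi]
  have H := (hasSum_ite_eq (0 : ℤ) (((Real.pi * q / 2 : ℝ) : ℂ) ^ 4)).add
    (hasSum_sin_pow_four_div_pow (r := 4) (by norm_num) (q := q) (s := 0)
      (y₁ := q) (y₂ := q / 2) (y₃ := 0) (y₄ := 1 - q / 2) (y₅ := 1 - q)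
      ⟨by linarith, by linarith⟩ ⟨by linarith, by linarith⟩ ⟨by linarith, by linarith⟩
      ⟨by linarith, by linarith⟩ ⟨by linarith, by linarith⟩
      (fun k => by simp) (fun k => by simp) (fun k => rfl)
      (fun k => by rw [← expTwoPi_mul_add_intCast k _ 1]; congr 2; push_cast; ring)
      (fun k => by rw [← expTwoPi_mul_add_intCast k _ 1]; congr 2; push_cast; ring))
  convert! H using 1
  simp only [bernoulliFun_four, mul_pow, Complex.I_pow_four]
  simp only [Nat.factorial]
  push_cast
  ring

theorem hasSum_sq_mul_splineCoeff_zero {q : ℝ} (hq : 0 < q) (hq1 : q ≤ 1) :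
    HasSum (fun k : ℤ => (((k : ℝ) ^ 2 * splineCoeff q k : ℝ) : ℂ) * expTwoPi (k * 0))
      ((Real.pi ^ 2 * q / 4 : ℝ) : ℂ) := by
  simp_rw [sq_mul_splineCoeff_mul_expTwoPi]
  have H := (hasSum_sin_pow_four_div_pow (r := 2) le_rfl (q := q) (s := 0)
      (y₁ := q) (y₂ := q / 2) (y₃ := 0) (y₄ := 1 - q / 2) (y₅ := 1 - q)
      ⟨by linarith, by linarith⟩ ⟨by linarith, by linarith⟩ ⟨by linarith, by linarith⟩
      ⟨by linarith, by linarith⟩ ⟨by linarith, by linarith⟩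
      (fun k => by simp) (fun k => by simp) (fun k => rfl)
      (fun k => by rw [← expTwoPi_mul_add_intCast k _ 1]; congr 2; push_cast; ring)
      (fun k => by rw [← expTwoPi_mul_add_intCast k _ 1]; congr 2; push_cast; ring))
  convert! H using 1
  simp only [bernoulliFun_two, mul_pow, Complex.I_sq]
  simp only [Nat.factorial]
  push_cast
  ring

/-- The spline vanishes at distance at least `q` from the integers. There all nodes of the fourth
central difference lie in one period, so the difference of the quartic Bernoulli polynomial is a
constant, which the zeroth coefficient cancels. -/
theorem hasSum_splineCoeff_of_mem {q s : ℝ} (hq : 0 < q) (hs : s ∈ Set.Icc q (1 - q)) :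
    HasSum (fun k : ℤ => (splineCoeff q k : ℂ) * expTwoPi (k * s)) 0 := by
  obtain ⟨hs₁, hs₂⟩ := hs
  simp_rw [splineCoeff_mul_expTwoPi]
  have H := (hasSum_ite_eq (0 : ℤ) (((Real.pi * q / 2 : ℝ) : ℂ) ^ 4)).add
    (hasSum_sin_pow_four_div_pow (r := 4) (by norm_num) (q := q) (s := s)
      ⟨by linarith, by linarith⟩ ⟨by linarith, by linarith⟩ ⟨by linarith, by linarith⟩
      ⟨by linarith, by linarith⟩ ⟨by linarith, by linarith⟩
      (fun k => rfl) (fun k => rfl) (fun k => rfl) (fun k => rfl) (fun k => rfl))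
  convert! H using 1
  simp only [bernoulliFun_four, mul_pow, Complex.I_pow_four]
  simp only [Nat.factorial]
  push_cast
  ring

/-- The second derivative of the spline vanishes at distance at least `q` from the integers. -/
theorem hasSum_sq_mul_splineCoeff_of_mem {q s : ℝ} (hq : 0 < q) (hs : s ∈ Set.Icc q (1 - q)) :
    HasSum (fun k : ℤ => (((k : ℝ) ^ 2 * splineCoeff q k : ℝ) : ℂ) * expTwoPi (k * s)) 0 := by
  obtain ⟨hs₁, hs₂⟩ := hs
  simp_rw [sq_mul_splineCoeff_mul_expTwoPi]
  have H := (hasSum_sin_pow_four_div_pow (r := 2) le_rfl (q := q) (s := s)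
      ⟨by linarith, by linarith⟩ ⟨by linarith, by linarith⟩ ⟨by linarith, by linarith⟩
      ⟨by linarith, by linarith⟩ ⟨by linarith, by linarith⟩
      (fun k => rfl) (fun k => rfl) (fun k => rfl) (fun k => rfl) (fun k => rfl))
  convert! H using 1
  simp only [bernoulliFun_two]
  push_cast
  ring

section

open Filter Topology

/-- The character `s ↦ e^{2πi k·s}` of the torus `ℝ^d / ℤ^d` with frequency `k`. -/
noncomputable def torusChar {d : ℕ} (k : Fin d → ℤ) (s : Fin d → ℝ) : ℂ :=
  ∏ i, expTwoPi (k i * s i)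

theorem torusChar_mul_conj {d : ℕ} (k : Fin d → ℤ) (s s' : Fin d → ℝ) :
    torusChar k s * (starRingEnd ℂ) (torusChar k s') = torusChar k (s - s') := by
  simp only [torusChar, map_prod, conj_expTwoPi, ← Finset.prod_mul_distrib, ← expTwoPi_add]
  refine Finset.prod_congr rfl fun i _ => ?_
  congr 1
  simp only [Pi.sub_apply]
  ring

theorem torusChar_add {d : ℕ} (k k' : Fin d → ℤ) (s : Fin d → ℝ) :
    torusChar (k + k') s = torusChar k s * torusChar k' s := by
  simp only [torusChar, ← Finset.prod_mul_distrib, ← expTwoPi_add]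
  refine Finset.prod_congr rfl fun i _ => ?_
  congr 1
  simp only [Pi.add_apply]
  push_cast
  ring

theorem torusChar_ne_zero {d : ℕ} (k : Fin d → ℤ) (s : Fin d → ℝ) : torusChar k s ≠ 0 :=
  Finset.prod_ne_zero_iff.mpr fun _ _ => expTwoPi_ne_zero _

/-! ### A weight that is nonpositive outside a cube of frequencies -/

/-- The symmetric cube `{-N, …, N}^d` of frequencies. -/
noncomputable def freqCube (d N : ℕ) : Finset (Fin d → ℤ) :=
  Fintype.piFinset fun _ => Finset.Icc (-(N : ℤ)) N

theorem tendsto_sum_freqCube_prod {d : ℕ} {φ : Fin d → ℤ → ℂ} {L : Fin d → ℂ}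
    (h : ∀ i, HasSum (φ i) (L i)) :
    Tendsto (fun N : ℕ => ∑ k ∈ freqCube d N, ∏ i, φ i (k i)) atTop (𝓝 (∏ i, L i)) := by
  simp only [freqCube, ← Finset.prod_univ_sum]
  exact tendsto_finsetProd _ fun i _ => (h i).comp (Finset.tendsto_Icc_neg (R := ℤ))

/-- A product of nonnegative sequences times `R² - |k|²`: a weight that is positive only in the
open Euclidean ball of radius `R`. -/
noncomputable def ballWeight {d : ℕ} (q R : ℝ) (k : Fin d → ℤ) : ℝ :=
  (R ^ 2 - ∑ i, (k i : ℝ) ^ 2) * ∏ i, splineCoeff q (k i)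

theorem ballWeight_mul_torusChar {d : ℕ} (q R : ℝ) (k : Fin d → ℤ) (s : Fin d → ℝ) :
    (ballWeight q R k : ℂ) * torusChar k s =
      (R : ℂ) ^ 2 * ∏ i, ((splineCoeff q (k i) : ℂ) * expTwoPi (k i * s i)) -
        ∑ i, ∏ i', if i' = i then
            (((k i' : ℝ) ^ 2 * splineCoeff q (k i') : ℝ) : ℂ) * expTwoPi (k i' * s i')
          else (splineCoeff q (k i') : ℂ) * expTwoPi (k i' * s i') := by
  have key : ∀ i : Fin d, (∏ i', if i' = i then
            (((k i' : ℝ) ^ 2 * splineCoeff q (k i') : ℝ) : ℂ) * expTwoPi (k i' * s i')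
          else (splineCoeff q (k i') : ℂ) * expTwoPi (k i' * s i')) =
      (k i : ℂ) ^ 2 * ∏ i', ((splineCoeff q (k i') : ℂ) * expTwoPi (k i' * s i')) := by
    intro i
    have : (k i : ℂ) ^ 2 = ∏ i', if i' = i then (k i' : ℂ) ^ 2 else 1 := by simp
    rw [this, ← Finset.prod_mul_distrib]
    refine Finset.prod_congr rfl fun i' _ => ?_
    split_ifs
    · push_cast
      ring
    · ring
  simp only [key, ← Finset.sum_mul, ← sub_mul, ballWeight, torusChar, Finset.prod_mul_distrib]
  push_cast
  ring

theorem tendsto_sum_ballWeight {d : ℕ} {q R : ℝ} {s : Fin d → ℝ} {A B : Fin d → ℂ}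
    (hA : ∀ i, HasSum (fun m : ℤ => (splineCoeff q m : ℂ) * expTwoPi (m * s i)) (A i))
    (hB : ∀ i, HasSum
      (fun m : ℤ => (((m : ℝ) ^ 2 * splineCoeff q m : ℝ) : ℂ) * expTwoPi (m * s i)) (B i)) :
    Tendsto (fun N : ℕ => ∑ k ∈ freqCube d N, (ballWeight q R k : ℂ) * torusChar k s) atTop
      (𝓝 ((R : ℂ) ^ 2 * ∏ i, A i - ∑ i, ∏ i', if i' = i then B i' else A i')) := by
  simp only [ballWeight_mul_torusChar, Finset.sum_sub_distrib, ← Finset.mul_sum]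
  refine (Tendsto.const_mul _ (tendsto_sum_freqCube_prod hA)).sub ?_
  simp_rw [Finset.sum_comm (s := freqCube d _)]
  refine tendsto_finsetSum _ fun i _ => ?_
  refine tendsto_sum_freqCube_prod (φ := fun i' m => if i' = i then
      (((m : ℝ) ^ 2 * splineCoeff q m : ℝ) : ℂ) * expTwoPi (m * s i')
    else (splineCoeff q m : ℂ) * expTwoPi (m * s i')) fun i' => ?_
  split_ifs
  · exact hB i'
  · exact hA i'

theorem summable_mul_expTwoPi {u : ℤ → ℝ} {a : ℂ}
    (h : HasSum (fun k : ℤ => (u k : ℂ) * expTwoPi (k * 0)) a) (s : ℝ) :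
    Summable fun k : ℤ => (u k : ℂ) * expTwoPi (k * s) := by
  have h' : Summable fun k : ℤ => ‖(u k : ℂ) * expTwoPi (k * 0)‖ := h.summable.norm
  refine Summable.of_norm (h'.congr fun k => ?_)
  have hn : ∀ x : ℝ, ‖expTwoPi x‖ = 1 := fun x => by
    rw [expTwoPi, Complex.norm_exp]
    simp
  simp [hn]

/-- The Fourier series of the weight vanishes at every point having a coordinate at distance at
least `q` from the integers. -/
theorem tendsto_sum_ballWeight_zero {d : ℕ} {q R : ℝ} (hq : 0 < q) (hq1 : q ≤ 1) {s : Fin d → ℝ}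
    {i₀ : Fin d} (hs : Int.fract (s i₀) ∈ Set.Icc q (1 - q)) :
    Tendsto (fun N : ℕ => ∑ k ∈ freqCube d N, (ballWeight q R k : ℂ) * torusChar k s) atTop
      (𝓝 0) := by
  have hA := fun i => (summable_mul_expTwoPi
    (hasSum_splineCoeff_zero hq hq1) (s i)).hasSum
  have hB := fun i => (summable_mul_expTwoPi
    (hasSum_sq_mul_splineCoeff_zero hq hq1) (s i)).hasSum
  have hfr : ∀ k : ℤ, expTwoPi (k * s i₀) = expTwoPi (k * Int.fract (s i₀)) := fun k => by
    rw [← expTwoPi_mul_add_intCast k (Int.fract (s i₀)) ⌊s i₀⌋, Int.fract_add_floor]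
  have hA0 := hasSum_splineCoeff_of_mem hq hs
  have hB0 := hasSum_sq_mul_splineCoeff_of_mem hq hs
  simp only [← hfr] at hA0 hB0
  convert! tendsto_sum_ballWeight (R := R) hA hB using 2
  rw [Finset.prod_eq_zero (Finset.mem_univ i₀) hA0.tsum_eq, Finset.sum_eq_zero, mul_zero, sub_zero]
  intro i _
  refine Finset.prod_eq_zero (Finset.mem_univ i₀) ?_
  split_ifs
  · exact hB0.tsum_eq
  · exact hA0.tsum_eq

theorem exists_tendsto_sum_ballWeight_pos {d : ℕ} (hd : 0 < d) {q R : ℝ} (hq : 0 < q) (hq1 : q ≤ 1)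
    (hR : 3 * d < (R * Real.pi * q) ^ 2) :
    ∃ W : ℝ, 0 < W ∧
      Tendsto (fun N : ℕ => ∑ k ∈ freqCube d N, (ballWeight q R k : ℂ) * torusChar k 0) atTop
        (𝓝 (W : ℂ)) := by
  set α : ℝ := Real.pi ^ 4 * q ^ 3 / 12 with hα
  set β : ℝ := Real.pi ^ 2 * q / 4 with hβ
  have hα0 : 0 < α := by positivity
  refine ⟨R ^ 2 * α ^ d - d * (β * α ^ (d - 1)), ?_, ?_⟩
  · obtain ⟨e, rfl⟩ : ∃ e, d = e + 1 := ⟨d - 1, by omega⟩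
    rw [Nat.add_sub_cancel, pow_succ α, show R ^ 2 * (α ^ e * α) - ((e + 1 : ℕ) : ℝ) * (β * α ^ e) =
      α ^ e * (R ^ 2 * α - ((e + 1 : ℕ) : ℝ) * β) by ring]
    refine mul_pos (pow_pos hα0 e) ?_
    have : R ^ 2 * α - ((e + 1 : ℕ) : ℝ) * β =
        Real.pi ^ 2 * q / 12 * ((R * Real.pi * q) ^ 2 - 3 * ((e + 1 : ℕ) : ℝ)) := by
      rw [hα, hβ]
      ring
    rw [this]
    exact mul_pos (by positivity) (by linarith)
  · convert! tendsto_sum_ballWeight (R := R) (s := (0 : Fin d → ℝ)) (A := fun _ => (α : ℂ))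
      (B := fun _ => (β : ℂ)) (fun _ => hasSum_splineCoeff_zero hq hq1)
      (fun _ => hasSum_sq_mul_splineCoeff_zero hq hq1) using 2
    have key : ∀ i : Fin d, (∏ i' : Fin d, if i' = i then (β : ℂ) else (α : ℂ)) =
        β * (α : ℂ) ^ (d - 1) := fun i => by
      rw [← Finset.mul_prod_erase _ _ (Finset.mem_univ i), if_pos rfl,
        Finset.prod_congr rfl fun i' hi' => if_neg (Finset.ne_of_mem_erase hi')]
      simp
    simp [key]

/-! ### Uniqueness for separated exponential sums -/

theorem sum_mul_normSq_eq {d M : ℕ} (S : Finset (Fin d → ℤ)) (w : (Fin d → ℤ) → ℝ) (b : Fin M → ℂ)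
    (t : Fin M → Fin d → ℝ) :
    ((∑ k ∈ S, w k * Complex.normSq (∑ j, b j * torusChar k (t j)) : ℝ) : ℂ) =
      ∑ j, ∑ l, b j * (starRingEnd ℂ) (b l) * ∑ k ∈ S, (w k : ℂ) * torusChar k (t j - t l) := by
  have : ∀ k, ((w k * Complex.normSq (∑ j, b j * torusChar k (t j)) : ℝ) : ℂ) =
      ∑ j, ∑ l, b j * (starRingEnd ℂ) (b l) * ((w k : ℂ) * torusChar k (t j - t l)) := by
    intro k
    rw [Complex.ofReal_mul, ← Complex.mul_conj, map_sum, Finset.sum_mul_sum, Finset.mul_sum]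
    refine Finset.sum_congr rfl fun j _ => ?_
    rw [Finset.mul_sum]
    refine Finset.sum_congr rfl fun l _ => ?_
    rw [← torusChar_mul_conj, map_mul]
    ring
  rw [Complex.ofReal_sum, Finset.sum_congr rfl fun k _ => this k, Finset.sum_comm]
  refine Finset.sum_congr rfl fun j _ => ?_
  rw [Finset.sum_comm]
  simp_rw [Finset.mul_sum]

/-- An exponential sum with separated nodes that vanishes on the cube `{-m, …, m}^d` is zero,
provided that the weight of radius `R = m + 1` has positive Fourier series at the origin. The
weighted sum of the squared moduli of its values is nonpositive, since every `k` outside the cube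
satisfies `|k| ≥ R`; expanded as a quadratic form in the coefficients it is a positive multiple of
`∑ |b_j|²`, since the mixed terms vanish. -/
theorem eq_zero_of_sum_torusChar_eq_zero {d M m : ℕ} (hd : 0 < d) {q : ℝ} (hq : 0 < q)
    (hq1 : q ≤ 1) (hm : 3 * d < ((m + 1 : ℝ) * Real.pi * q) ^ 2) {t : Fin M → Fin d → ℝ}
    (ht : ∀ j l, j ≠ l → ∃ i, Int.fract ((t j - t l) i) ∈ Set.Icc q (1 - q)) {b : Fin M → ℂ}
    (hb : ∀ k : Fin d → ℤ, (∀ i, |k i| ≤ m) → ∑ j, b j * torusChar k (t j) = 0) : b = 0 := by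
  obtain ⟨W, hW, hlim⟩ := exists_tendsto_sum_ballWeight_pos hd hq hq1 hm
  have hT : Tendsto (fun N : ℕ => ((∑ k ∈ freqCube d N, ballWeight q (m + 1) k *
      Complex.normSq (∑ j, b j * torusChar k (t j)) : ℝ) : ℂ)) atTop
      (𝓝 (∑ j, ∑ l, b j * (starRingEnd ℂ) (b l) * if j = l then (W : ℂ) else 0)) := by
    simp_rw [sum_mul_normSq_eq]
    refine tendsto_finsetSum _ fun j _ => tendsto_finsetSum _ fun l _ => Tendsto.const_mul _ ?_
    split_ifs with hjl
    · rw [hjl, sub_self]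
      exact hlim
    · obtain ⟨i, hi⟩ := ht j l hjl
      exact tendsto_sum_ballWeight_zero hq hq1 hi
  have hL : (∑ j, ∑ l, b j * (starRingEnd ℂ) (b l) * if j = l then (W : ℂ) else 0) =
      ((∑ j, Complex.normSq (b j) * W : ℝ) : ℂ) := by
    simp [Complex.mul_conj]
  rw [hL] at hT
  have hT' := (Complex.continuous_re.tendsto _).comp hT
  simp only [Function.comp_def, Complex.ofReal_re] at hT'
  have hle : ∑ j, Complex.normSq (b j) * W ≤ 0 := by
    refine le_of_tendsto' hT' fun N => Finset.sum_nonpos fun k _ => ?_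
    by_cases hk : ∀ i, |k i| ≤ m
    · rw [hb k hk]
      simp
    · push Not at hk
      obtain ⟨i, hi⟩ := hk
      refine mul_nonpos_of_nonpos_of_nonneg (mul_nonpos_of_nonpos_of_nonneg ?_
        (Finset.prod_nonneg fun i _ => splineCoeff_nonneg q _)) (Complex.normSq_nonneg _)
      have h1 : (m + 1 : ℝ) ≤ |(k i : ℝ)| := by
        exact_mod_cast (show (m : ℤ) + 1 ≤ |k i| by omega)
      have h2 : (m + 1 : ℝ) ^ 2 ≤ (k i : ℝ) ^ 2 := by
        rw [← sq_abs (k i : ℝ)]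
        gcongr
      have h3 : (k i : ℝ) ^ 2 ≤ ∑ i, (k i : ℝ) ^ 2 :=
        Finset.single_le_sum (f := fun i => (k i : ℝ) ^ 2) (fun i _ => sq_nonneg _)
          (Finset.mem_univ i)
      linarith
  have h0 : ∀ j ∈ Finset.univ, 0 ≤ Complex.normSq (b j) * W := fun j _ =>
    mul_nonneg (Complex.normSq_nonneg _) hW.le
  have := (Finset.sum_eq_zero_iff_of_nonneg h0).mp (le_antisymm hle (Finset.sum_nonneg h0))
  funext j
  simpa [hW.ne'] using this j (Finset.mem_univ j)

end

/-! ### Linear independence of the Vandermonde rows -/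

theorem QSeparated.exists_fract_mem {d M : ℕ} {q : ℝ} {t : Fin M → Fin d → ℝ} (hq : 0 < q)
    (h : QSeparated q t) {j l : Fin M} (hjl : j ≠ l) :
    ∃ i, Int.fract ((t j - t l) i) ∈ Set.Icc q (1 - q) := by
  have key : ENNReal.ofReal q <
      ENNReal.ofReal ‖t j - t l + fun i => ((-round ((t j - t l) i) : ℤ) : ℝ)‖ :=
    lt_of_lt_of_le h
      (((iInf_le _ j).trans (iInf_le _ l)).trans ((iInf_le _ hjl).trans (iInf_le _ _)))
  have key' := (ENNReal.ofReal_lt_ofReal_iff'.mp key).1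
  by_contra! hcon
  refine absurd key' (not_lt.mpr ((pi_norm_le_iff_of_nonneg hq.le).mpr fun i => ?_))
  have hi := hcon i
  rw [Pi.add_apply, Int.cast_neg, ← sub_eq_add_neg, Real.norm_eq_abs, abs_sub_round_eq_min]
  by_contra! hlt
  rw [lt_min_iff] at hlt
  exact hi ⟨hlt.1.le, by linarith [hlt.2]⟩

theorem torusPoint_apply {d : ℕ} (t : Fin d → ℝ) (i : Fin d) :
    torusPoint t i = expTwoPi (t i) := rfl

theorem torusChar_natCast {d : ℕ} (k : Fin d → ℕ) (s : Fin d → ℝ) :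
    torusChar (fun i => (k i : ℤ)) s = ∏ i, torusPoint s i ^ k i := by
  refine Finset.prod_congr rfl fun i _ => ?_
  rw [expTwoPi_intCast_mul, torusPoint_apply, zpow_natCast]

/-- In dimension one the separation allows at most one node in each interval `[a/n, (a+1)/n)`,
hence at most `n` nodes, and the Vandermonde determinant of the nodes is nonzero. -/
theorem eq_zero_of_sum_mul_prod_pow_eq_zero_dim_one {M n : ℕ} {t : Fin M → Fin 1 → ℝ}
    (ht : ∀ j i, t j i ∈ Set.Ico (0 : ℝ) 1) (hinj : Function.Injective fun j => torusPoint (t j))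
    {q : ℝ} (hsep : ∀ j l, j ≠ l → ∃ i, Int.fract ((t j - t l) i) ∈ Set.Icc q (1 - q))
    (hq : 0 < q) (hn : 1 / q < n) {a : Fin M → ℂ}
    (ha : ∀ k : Fin 1 → Fin n, ∑ j, a j * ∏ i, torusPoint (t j) i ^ (k i : ℕ) = 0) : a = 0 := by
  have hn0 : (0 : ℝ) < n := (one_div_pos.mpr hq).trans hn
  have hfl : ∀ j, ⌊t j 0 * n⌋₊ < n := fun j => by
    rw [Nat.floor_lt (mul_nonneg (ht j 0).1 hn0.le)]
    nlinarith [(ht j 0).2]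
  have hMn : M ≤ n := by
    have hcard := Fintype.card_le_of_injective (fun j => (⟨⌊t j 0 * n⌋₊, hfl j⟩ : Fin n)) ?_
    · simpa using hcard
    intro j l hjl
    by_contra hne
    have hjl' : ⌊t j 0 * n⌋₊ = ⌊t l 0 * n⌋₊ := congrArg Fin.val hjl
    have a1 := Nat.floor_le (mul_nonneg (ht j 0).1 hn0.le)
    have a2 := Nat.lt_floor_add_one (t j 0 * n)
    have b1 := Nat.floor_le (mul_nonneg (ht l 0).1 hn0.le)
    have b2 := Nat.lt_floor_add_one (t l 0 * n)
    rw [hjl'] at a1 a2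
    have hqn : 1 < q * n := by rwa [div_lt_iff₀' hq] at hn
    -- One of the two differences is its own fractional part, and it is too small.
    have aux : ∀ j l, j ≠ l → 0 ≤ t j 0 - t l 0 → (t j 0 - t l 0) * n < 1 → False := by
      intro j l hne h0 h1
      obtain ⟨i, hi⟩ := hsep j l hne
      rw [Fin.fin_one_eq_zero i, Pi.sub_apply,
        Int.fract_eq_self.mpr ⟨h0, by linarith [(ht j 0).2, (ht l 0).1]⟩] at hi
      nlinarith [hi.1]
    rcases le_total (t l 0) (t j 0) with h | h
    · exact aux j l hne (by linarith) (by linarith)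
    · exact aux l j (Ne.symm hne) (by linarith) (by linarith)
  refine Matrix.eq_zero_of_forall_pow_sum_mul_pow_eq_zero (f := fun j => torusPoint (t j) 0) ?_
    fun i => ?_
  · intro j l hjl
    refine hinj (funext fun i => ?_)
    rw [Fin.fin_one_eq_zero i]
    exact hjl
  · simpa using ha fun _ => Fin.castLE hMn i

/-- The rows `(x_j^k)_{k ∈ {0,…,n-1}^d}` of the multivariate Vandermonde matrix are linearly
independent. -/
theorem eq_zero_of_sum_mul_prod_pow_eq_zero {d M n : ℕ} (hd : 0 < d) {t : Fin M → Fin d → ℝ}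
    (ht : ∀ j i, t j i ∈ Set.Ico (0 : ℝ) 1) (hinj : Function.Injective fun j => torusPoint (t j))
    {q : ℝ} (hq : 0 < q) (hsep : QSeparated q t) (hn : (d : ℝ) ^ (3 / 2 : ℝ) / q < n)
    {a : Fin M → ℂ}
    (ha : ∀ k : Fin d → Fin n, ∑ j, a j * ∏ i, torusPoint (t j) i ^ (k i : ℕ) = 0) : a = 0 := by
  have hfr := fun j l (hjl : j ≠ l) => hsep.exists_fract_mem hq hjl
  have hn0 : 0 < n := by
    have : (0 : ℝ) ≤ (d : ℝ) ^ (3 / 2 : ℝ) / q := by positivity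
    exact_mod_cast this.trans_lt hn
  by_cases hM : ∀ j l : Fin M, j = l
  · funext j
    have h0 := ha fun _ => ⟨0, hn0⟩
    have : Subsingleton (Fin M) := ⟨hM⟩
    rw [Fintype.sum_subsingleton _ j] at h0
    simpa using h0
  push Not at hM
  obtain ⟨j₁, j₂, hne⟩ := hM
  obtain ⟨_, hi⟩ := hfr j₁ j₂ hne
  have hq1 : q ≤ 1 := by linarith [hi.1, hi.2]
  obtain rfl | hd2 : d = 1 ∨ 2 ≤ d := by omega
  · exact eq_zero_of_sum_mul_prod_pow_eq_zero_dim_one ht hinj hfr hq (by simpa using hn) ha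
  obtain ⟨m, hm1, hm2⟩ : ∃ m : ℕ, 2 * m < n ∧ n ≤ 2 * (m + 1) := ⟨(n - 1) / 2, by omega, by omega⟩
  have hb : (fun j => a j * torusChar (fun _ => (m : ℤ)) (t j)) = 0 := by
    refine eq_zero_of_sum_torusChar_eq_zero (m := m) hd hq hq1 ?_ hfr fun k hk => ?_
    · have h1 : (d : ℝ) ^ (3 / 2 : ℝ) < n * q := by rwa [div_lt_iff₀ hq] at hn
      have h2 : ((d : ℝ) ^ (3 / 2 : ℝ)) ^ 2 = (d : ℝ) ^ 3 := by
        rw [← Real.rpow_natCast, ← Real.rpow_mul (Nat.cast_nonneg d), ← Real.rpow_natCast]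
        norm_num
      have h3 : (n : ℝ) ≤ 2 * (m + 1) := by exact_mod_cast hm2
      have h4 : (d : ℝ) ^ (3 / 2 : ℝ) < 2 * ((m + 1) * q) := by nlinarith
      have h5 : (d : ℝ) ^ 3 < (2 * ((m + 1) * q)) ^ 2 := by
        rw [← h2]
        exact pow_lt_pow_left₀ h4 (by positivity) two_ne_zero
      have hd2' : (2 : ℝ) ≤ d := by exact_mod_cast hd2
      have h6 : 4 * (d : ℝ) ≤ (d : ℝ) ^ 3 := by
        have : (2 : ℝ) ^ 2 ≤ (d : ℝ) ^ 2 := by gcongr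
        nlinarith
      have h7 : (3 : ℝ) ^ 2 ≤ Real.pi ^ 2 := by
        gcongr
        exact Real.pi_gt_three.le
      have h8 : ((m + 1) * Real.pi * q) ^ 2 = Real.pi ^ 2 * ((m + 1) * q) ^ 2 := by ring
      rw [h8]
      nlinarith [sq_nonneg ((m + 1 : ℝ) * q)]
    · have hk' : ∀ i, ((k i + m).toNat : ℤ) = k i + m ∧ (k i + m).toNat < n := fun i => by
        have := abs_le.mp (hk i)
        omega
      rw [← ha fun i => ⟨(k i + m).toNat, (hk' i).2⟩]
      refine Finset.sum_congr rfl fun j _ => ?_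
      rw [← torusChar_natCast, mul_assoc, ← torusChar_add]
      congr 2
      funext i
      rw [(hk' i).1, Pi.add_apply, add_comm]
  funext j
  simpa [torusChar_ne_zero] using congrFun hb j

/-! ### Lagrange interpolation and the zero set -/

/-- Evaluation at `z`, as a linear functional of the coefficient vector of a polynomial. -/
noncomputable def evalVec {d n : ℕ} (z : Fin d → ℂ) : ((Fin d → Fin n) → ℂ) →ₗ[ℂ] ℂ :=
  ∑ k : Fin d → Fin n, (∏ i, z i ^ (k i : ℕ)) • LinearMap.proj k

theorem evalVec_apply {d n : ℕ} (z : Fin d → ℂ) (p : (Fin d → Fin n) → ℂ) :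
    evalVec z p = ∑ k, p k * ∏ i, z i ^ (k i : ℕ) := by
  simp [evalVec, mul_comm]

theorem evalVec_single {d n : ℕ} (z : Fin d → ℂ) (k : Fin d → Fin n) :
    evalVec z (Pi.single k 1) = ∏ i, z i ^ (k i : ℕ) := by
  simp [evalVec_apply, Pi.single_apply]

theorem eval_polyOfVec {d n : ℕ} (z : Fin d → ℂ) (p : (Fin d → Fin (n + 1)) → ℂ) :
    MvPolynomial.eval z (polyOfVec p) = evalVec z p := by
  rw [polyOfVec, map_sum, evalVec_apply]
  refine Finset.sum_congr rfl fun k _ => ?_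
  rw [MvPolynomial.eval_monomial, Finsupp.prod_fintype _ _ fun i => pow_zero _]
  rfl

theorem mem_commonZeros_kernelPolys {d n : ℕ}
    {A : Matrix (Fin d → Fin (n + 1)) (Fin d → Fin (n + 1)) ℂ} {z : Fin d → ℂ} :
    z ∈ commonZeros (kernelPolys A) ↔ ∀ p, A.mulVec p = 0 → evalVec z p = 0 := by
  simp [commonZeros, kernelPolys, eval_polyOfVec]

/-- Coefficient vector of a polynomial, regarded as one of higher degree. -/
noncomputable def raiseDegree {d n : ℕ} (p : (Fin d → Fin n) → ℂ) : (Fin d → Fin (n + 1)) → ℂ :=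
  ∑ k, p k • Pi.single (fun i => (k i).castSucc) 1

theorem evalVec_raiseDegree {d n : ℕ} (z : Fin d → ℂ) (p : (Fin d → Fin n) → ℂ) :
    evalVec z (raiseDegree p) = evalVec z p := by
  simp [raiseDegree, evalVec_single, evalVec_apply z p]

/-- Coefficient vector of the product of a polynomial with the variable `X i₀`. -/
noncomputable def mulVar {d n : ℕ} (i₀ : Fin d) (p : (Fin d → Fin n) → ℂ) :
    (Fin d → Fin (n + 1)) → ℂ :=
  ∑ k, p k • Pi.single (fun i => if i = i₀ then (k i).succ else (k i).castSucc) 1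

theorem evalVec_mulVar {d n : ℕ} (z : Fin d → ℂ) (i₀ : Fin d) (p : (Fin d → Fin n) → ℂ) :
    evalVec z (mulVar i₀ p) = z i₀ * evalVec z p := by
  rw [mulVar, map_sum, evalVec_apply z p, Finset.mul_sum]
  refine Finset.sum_congr rfl fun k _ => ?_
  rw [map_smul, evalVec_single, smul_eq_mul, mul_left_comm]
  congr 1
  have : z i₀ = ∏ i, if i = i₀ then z i else 1 := by simp
  rw [this, ← Finset.prod_mul_distrib]
  refine Finset.prod_congr rfl fun i _ => ?_
  split_ifs
  · simp [pow_succ']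
  · simp

/-- Linear independence of the rows of the Vandermonde matrix gives Lagrange polynomials. -/
theorem exists_lagrange {d M n : ℕ} {x : Fin M → Fin d → ℂ}
    (hx : ∀ a : Fin M → ℂ,
      (∀ k : Fin d → Fin n, ∑ j, a j * ∏ i, x j i ^ (k i : ℕ) = 0) → a = 0) :
    ∃ L : Fin M → (Fin d → Fin n) → ℂ, ∀ j l, evalVec (x l) (L j) = if j = l then 1 else 0 := by
  set V : Matrix (Fin M) (Fin d → Fin n) ℂ := Matrix.of fun j k => ∏ i, x j i ^ (k i : ℕ) with hV
  have hli : LinearIndependent ℂ V.row := by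
    rw [Fintype.linearIndependent_iff]
    intro a ha j
    refine congrFun (hx a fun k => ?_) j
    simpa [hV] using congrFun ha k
  have htop : LinearMap.range V.mulVecLin = ⊤ :=
    Submodule.eq_top_of_finrank_eq (by simpa [Matrix.rank] using hli.rank_matrix)
  choose L hL using fun j : Fin M => LinearMap.range_eq_top.mp htop (Pi.single j 1)
  refine ⟨L, fun j l => ?_⟩
  have := congrFun (hL j) l
  rw [Pi.single_apply] at this
  simp only [eq_comm (a := j)]
  rw [← this, evalVec_apply]
  simp [hV, Matrix.mulVec, dotProduct, mul_comm]

/-- If Lagrange polynomials exist in degree `n - 1`, a finite set is cut out by the polynomials of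
degree `n` that vanish on it: among these are `(X_i - x_{j,i}) L_j` and `1 - ∑ L_j`. -/
theorem mem_range_of_forall_evalVec_eq_zero {d M n : ℕ} {x : Fin M → Fin d → ℂ}
    {L : Fin M → (Fin d → Fin n) → ℂ} (hL : ∀ j l, evalVec (x l) (L j) = if j = l then 1 else 0)
    {z : Fin d → ℂ}
    (hz : ∀ p : (Fin d → Fin (n + 1)) → ℂ, (∀ j, evalVec (x j) p = 0) → evalVec z p = 0) :
    z ∈ Set.range x := by
  by_contra hmem
  have hLz : ∀ j, evalVec z (L j) = 0 := fun j => by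
    obtain ⟨i, hi⟩ : ∃ i, z i ≠ x j i := by
      by_contra! hcon
      exact hmem ⟨j, (funext hcon).symm⟩
    have h := hz (mulVar i (L j) - x j i • raiseDegree (L j)) fun l => by
      rw [map_sub, map_smul, evalVec_mulVar, evalVec_raiseDegree, hL]
      split_ifs with h
      · simp [h]
      · simp
    rw [map_sub, map_smul, evalVec_mulVar, evalVec_raiseDegree, smul_eq_mul, ← sub_mul] at h
    exact (mul_eq_zero.mp h).resolve_left (sub_ne_zero.mpr hi)
  have h := hz (Pi.single 0 1 - ∑ j, raiseDegree (L j)) fun l => by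
    simp [evalVec_single, evalVec_raiseDegree, hL]
  simp [evalVec_single, evalVec_raiseDegree, hLz] at h

/-! ### The kernel of the Toeplitz matrix -/

theorem toeplitzMatrix_mulVec_apply {d M n : ℕ} {f : (Fin d → ℤ) → ℂ} {c : Fin M → ℂ}
    {x : Fin M → Fin d → ℂ} (hf : IsExpSum f c x) (p : (Fin d → Fin (n + 1)) → ℂ)
    (k : Fin d → Fin (n + 1)) :
    (toeplitzMatrix n f).mulVec p k =
      ∑ j, c j * evalVec (x j) p * ∏ i, (x j i)⁻¹ ^ (k i : ℕ) := by
  simp only [Matrix.mulVec, dotProduct, toeplitzMatrix, Matrix.of_apply, hf.eq_sum, evalVec_apply,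
    Finset.mul_sum, Finset.sum_mul]
  rw [Finset.sum_comm]
  refine Finset.sum_congr rfl fun j _ => Finset.sum_congr rfl fun l _ => ?_
  have : ∏ i, x j i ^ (((l i : ℕ) : ℤ) - ((k i : ℕ) : ℤ)) =
      (∏ i, x j i ^ (l i : ℕ)) * ∏ i, (x j i)⁻¹ ^ (k i : ℕ) := by
    rw [← Finset.prod_mul_distrib]
    refine Finset.prod_congr rfl fun i _ => ?_
    rw [zpow_sub₀ (hf.param_ne_zero j i), zpow_natCast, zpow_natCast, inv_pow, div_eq_mul_inv]
  rw [this]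
  ring

/-- The kernel of the Toeplitz matrix consists of the polynomials vanishing at all parameters. -/
theorem toeplitzMatrix_mulVec_eq_zero_iff {d M n : ℕ} {f : (Fin d → ℤ) → ℂ} {c : Fin M → ℂ}
    {t : Fin M → Fin d → ℝ} (hf : IsExpSum f c fun j => torusPoint (t j))
    (hx : ∀ a : Fin M → ℂ,
      (∀ k : Fin d → Fin n, ∑ j, a j * ∏ i, torusPoint (t j) i ^ (k i : ℕ) = 0) → a = 0)
    (p : (Fin d → Fin (n + 1)) → ℂ) :
    (toeplitzMatrix n f).mulVec p = 0 ↔ ∀ j, evalVec (torusPoint (t j)) p = 0 := by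
  refine ⟨fun h => ?_, fun h => ?_⟩
  -- On the torus inversion is conjugation, so the conjugated equations are Vandermonde equations.
  · have h0 := hx (fun j => (starRingEnd ℂ) (c j * evalVec (torusPoint (t j)) p)) fun k => by
      have hk := congrArg (starRingEnd ℂ) (congrFun h fun i => (k i).castSucc)
      rw [toeplitzMatrix_mulVec_apply hf] at hk
      simpa [torusPoint_apply, conj_expTwoPi, expTwoPi_neg] using hk
    intro j
    simpa [hf.coeff_ne_zero j] using congrFun h0 j
  · funext k
    simp [toeplitzMatrix_mulVec_apply hf, h]

/-! ### Recovery of the parameters -/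

theorem mainTheorem3 (d M n : ℕ) (hd : 0 < d) (hM : 0 < M)
    (f : (Fin d → ℤ) → ℂ) (c : Fin M → ℂ)
    (t : Fin M → Fin d → ℝ) (ht : ∀ j i, t j i ∈ Set.Ico (0 : ℝ) 1)
    (hf : IsExpSum f c fun j => torusPoint (t j))
    (q : ℝ) (hq : 0 < q) (hsep : QSeparated q t)
    (hn : (d : ℝ) ^ (3 / 2 : ℝ) / q + (d : ℝ) + 1 < (n : ℝ)) :
    Set.range (fun j => torusPoint (t j)) = commonZeros (kernelPolys (toeplitzMatrix n f)) := by
  have hn' : (d : ℝ) ^ (3 / 2 : ℝ) / q < n := by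
    have : (0 : ℝ) ≤ d := Nat.cast_nonneg d
    linarith
  have hx := fun a : Fin M → ℂ =>
    eq_zero_of_sum_mul_prod_pow_eq_zero hd ht hf.param_injective hq hsep hn' (a := a)
  obtain ⟨L, hL⟩ := exists_lagrange hx
  ext z
  simp only [mem_commonZeros_kernelPolys, toeplitzMatrix_mulVec_eq_zero_iff hf hx]
  refine ⟨?_, fun hz => mem_range_of_forall_evalVec_eq_zero hL hz⟩
  rintro ⟨j, rfl⟩ p hp
  exact hp j
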